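/- Let $\Sigma$ be a finite alphabet. A timed word is a finite sequence $(t_1\cdot a_1)\cdots(t_n\cdot a_n)$ with $t_i\in\mathbb{R}_{\ge 0}$, $a_i\in\Sigma$; a timed language is a set $L$ of timed words, and $u^{-1}L=\{w\mid uw\in L\}$. A one-clock timed automaton has a finite state set, an initial state, a set of final states, and finitely many transitions $(q,q',a,\phi,r)$, where $r\in\{0,1\}$ and the guard $\phi$ is a finite non-empty conjunction of constraints $c<x$, $x=c$, $x<c$ with $c\in\mathbb{N}$. From configuration $(q,\nu)$ it reads $(t\cdot a)$ along such a transition if $\nu+t$ satisfies $\phi$, and moves to $(q',(\nu+t)r)$; a word is accepted if some run on it from the initial state with clock value $0$ ends in a final state. The automaton is a 1-DTA if any two distinct transitions with the same source and the same letter have disjoint guards. Its maximum constant is the largest constant occurring in its transitions ($0$ if it has none). $L$ is 1-DTA recognizable if it is accepted by some 1-DTA; then $K_L$ denotes the smallest $K\in\mathbb{N}$ such that some 1-DTA with maximum constant $K$ accepts $L$. For $y,z\in\mathbb{R}_{\ge0}$ write $y\equiv z$ if $\lfloor y\rfloor=\lfloor z\rfloor$ and ($\{y\}=0\Leftrightarrow\{z\}=0$),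 where $\{\cdot\}$ is the fractional part. For $K\in\mathbb{N}\cup\{\infty\}$ write $y\equiv^K z$ if $y\equiv z$ or both $y>K$ and $z>K$. Let $\mathrm{hi}(x)=x$ if $\{x\}=0$ and $\mathrm{hi}(x)=\lfloor x\rfloor+\frac12$ otherwise. A timed word is half-integral if all its delays are of the form $\frac m2$, $m\in\mathbb{N}$; let $\mathcal{HI}$ be the set of half-integral words. A reset function is a map $R$ from timed words to $\mathbb{R}_{\ge0}$ with $R(\epsilon)=0$ and $R(u(t\cdot a))\in\{0,R(u)+t\}$ for all $u,t,a$. Its normal form map is given by $N^R(\epsilon)=\epsilon$ and $N^R(u(t\cdot a))=N^R(u)(t'\cdot a)$, where $t'$ is the unique delay of the form $\frac n2$, $n\in\mathbb{N}$, with $R(u)+t\equiv \mathrm{hi}(R(u))+t'$. A profile is a pair $(R,\approx)$ of a reset function and an equivalence relation on $\mathcal{HI}$. Let $K_{(R,\approx)}\in\mathbb{N}\cup\{\infty\}$ be the least $K\in\mathbb{N}$ such that for all $u\in\mathcal{HI}$, $a\in\Sigma$, $n\in\mathbb{N}$, $R(u)+\frac n2>K$ implies $u(\frac n2\cdot a)\approx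 u((K+\frac12)\cdot a)$, and $\infty$ if there is no such $K$. The profile - is $L$-preserving if for all $u,v\in\mathcal{HI}$, $u\approx v$ implies ($u\in L\Leftrightarrow v\in L$), and for every timed word $w$, $w\in L\Leftrightarrow N^R(w)\in L$; - has finite index if $\approx$ has finitely many classes and $K_{(R,\approx)}<\infty$; - is monotonic if for all $u,v\in\mathcal{HI}$, $u\approx v$ implies (a) $R(u)\equiv^{K_{(R,\approx)}}R(v)$ and (b) $u(\frac n2\cdot a)\approx v(\frac n2\cdot a)$ for all $n\in\mathbb{N}$, $a\in\Sigma$; and (c) $R(w)\equiv R(N^R(w))$ for every timed word $w$. The syntactic reset function of $L$ is defined by $\mathbf{R}^L(\epsilon)=0$, and $\mathbf{R}^L(u(t\cdot a))=0$ if $(u(t\cdot a))^{-1}L$ is 1-DTA recognizable, $\mathbf{R}^L(u(t\cdot a))=\mathbf{R}^L(u)+t$ otherwise. The syntactic profile of $L$ is $(\mathbf{R}^L,\approx^L)$, where for $u,v\in\mathcal{HI}$, $u\approx^L v$ iff $\mathbf{R}^L(u)=\mathbf{R}^L(v)$ and $u^{-1}L=v^{-1}L$. **Proposition.** If $L$ is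 1-DTA recognizable, then $(\mathbf{R}^L,\approx^L)$ is $L$-preserving, monotonic and of finite index, and $K_{(\mathbf{R}^L,\approx^L)}=K_L$. -/

import Mathlib

open scoped NNReal

namespace OneClock

universe u

/-! ### Timed words, timed languages, residuals -/

/-- A timed word `(t₁·a₁)⋯(tₙ·aₙ)`: a finite sequence of (delay, letter) pairs. -/
abbrev TimedWord (α : Type u) : Type u := List (ℝ≥0 × α)

/-- A timed language. -/
abbrev TimedLanguage (α : Type u) : Type u := Set (TimedWord α)

/-- The residual language `u⁻¹L = {w | uw ∈ L}`. -/
def residual {α : Type u} (u : TimedWord α) (L : TimedLanguage α) : TimedLanguage α :=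
  {w | u ++ w ∈ L}

/-! ### One-clock timed automata -/

/-- Clock constraints `φ ::= c < x | x = c | x < c | φ ∧ φ` with `c ∈ ℕ`. -/
inductive ClockConstraint : Type where
  | gt (c : ℕ) : ClockConstraint
  | eq (c : ℕ) : ClockConstraint
  | lt (c : ℕ) : ClockConstraint
  | and (φ ψ : ClockConstraint) : ClockConstraint

/-- The set `⟦φ⟧` of clock values satisfying `φ`. -/
def ClockConstraint.denote : ClockConstraint → Set ℝ≥0
  | .gt c => {x | (c : ℝ≥0) < x}
  | .eq c => {x | x = (c : ℝ≥0)}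
  | .lt c => {x | x < (c : ℝ≥0)}
  | .and φ ψ => φ.denote ∩ ψ.denote

/-- The largest constant occurring in a clock constraint. -/
def ClockConstraint.maxConst : ClockConstraint → ℕ
  | .gt c => c
  | .eq c => c
  | .lt c => c
  | .and φ ψ => max φ.maxConst ψ.maxConst

/-- A transition `(q, q', a, φ, r)`; `reset = true` encodes `r = 0` (the clock is reset) and
`reset = false` encodes `r = 1` (the clock is not reset). -/
structure Transition (α : Type u) (Q : Type) : Type u where
  source : Q
  target : Q
  letter : α
  guard : ClockConstraint
  reset : Bool

/-- A one-clock timed automaton over the alphabet `α`. -/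
structure OneTA (α : Type u) : Type (max u 1) where
  State : Type
  finite_state : Finite State
  init : State
  trans : Finset (Transition α State)
  final : Set State

namespace OneTA

variable {α : Type u}

/-- Two distinct transitions with the same source and the same letter have disjoint guards. -/
def Deterministic (A : OneTA α) : Prop :=
  ∀ θ ∈ A.trans, ∀ θ' ∈ A.trans, θ ≠ θ' →
    θ.source ≠ θ'.source ∨ θ.letter ≠ θ'.letter ∨ θ.guard.denote ∩ θ'.guard.denote = ∅

/-- The maximum constant of the automaton: the largest constant occurring in its transitions
(`0` if there is no transition). -/
def maxConst (A : OneTA α) : ℕ := A.trans.sup fun θ => θ.guard.maxConst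

/-- `A.Reaches q ν w q' ν'`: there is a run on `w` from the configuration `(q, ν)` to the
configuration `(q', ν')`. -/
def Reaches (A : OneTA α) : A.State → ℝ≥0 → TimedWord α → A.State → ℝ≥0 → Prop
  | q, ν, [], q', ν' => q = q' ∧ ν = ν'
  | q, ν, (t, a) :: w, q', ν' => ∃ θ ∈ A.trans, θ.source = q ∧ θ.letter = a ∧
      ν + t ∈ θ.guard.denote ∧
      Reaches A θ.target (if θ.reset then 0 else ν + t) w q' ν'

/-- The language accepted from a configuration. -/
def languageFrom (A : OneTA α) (q : A.State) (ν : ℝ≥0) : TimedLanguage α :=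
  {w | ∃ q' ν', A.Reaches q ν w q' ν' ∧ q' ∈ A.final}

/-- The language of the automaton. -/
def language (A : OneTA α) : TimedLanguage α := A.languageFrom A.init 0

end OneTA

/-- `L` is the language of some deterministic one-clock timed automaton. -/
def IsRecognizable {α : Type u} (L : TimedLanguage α) : Prop :=
  ∃ A : OneTA α, A.Deterministic ∧ A.language = L

/-- `K_L`: the smallest `K` such that some deterministic one-clock timed automaton with maximum
constant `K` accepts `L` (only meaningful when `L` is recognizable; then the minimum exists). -/
noncomputable def minConstant {α : Type u} (L : TimedLanguage α) : ℕ :=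
  sInf {K : ℕ | ∃ A : OneTA α, A.Deterministic ∧ A.maxConst = K ∧ A.language = L}

/-! ### Regions -/

/-- The fractional part. -/
noncomputable def frac (y : ℝ≥0) : ℝ≥0 := y - (⌊y⌋₊ : ℝ≥0)

/-- Region equivalence `y ≡ z`. -/
def RegionEquiv (y z : ℝ≥0) : Prop :=
  ⌊y⌋₊ = ⌊z⌋₊ ∧ (frac y = 0 ↔ frac z = 0)

/-- Region equivalence `y ≡^K z` with respect to a constant `K ∈ ℕ ∪ {∞}`; for `K = ∞` it is
`y ≡ z`. -/
def RegionEquivUpTo (K : ℕ∞) (y z : ℝ≥0) : Prop :=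
  RegionEquiv y z ∨ ∃ k : ℕ, K = (k : ℕ∞) ∧ (k : ℝ≥0) < y ∧ (k : ℝ≥0) < z

open Classical in
/-- The half-integral representative of the region of `x`. -/
noncomputable def hi (x : ℝ≥0) : ℝ≥0 :=
  if frac x = 0 then x else (⌊x⌋₊ : ℝ≥0) + 1 / 2

/-! ### Reset functions -/

/-- `R` is a reset function. -/
def IsResetFunction {α : Type u} (R : TimedWord α → ℝ≥0) : Prop :=
  R [] = 0 ∧ ∀ (u : TimedWord α) (t : ℝ≥0) (a : α),
    R (u ++ [(t, a)]) = 0 ∨ R (u ++ [(t, a)]) = R u + t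

open Classical in
/-- The syntactic reset function `R^L`, defined prefix by prefix. -/
noncomputable def syntacticReset {α : Type u} (L : TimedLanguage α) (w : TimedWord α) : ℝ≥0 :=
  List.reverseRecOn (motive := fun _ => ℝ≥0) w 0 fun u x r =>
    if IsRecognizable (residual (u ++ [x]) L) then 0 else r + x.1

theorem syntacticReset_nil {α : Type u} (L : TimedLanguage α) : syntacticReset L [] = 0 := by
  simp [syntacticReset]

open Classical in
theorem syntacticReset_snoc {α : Type u} (L : TimedLanguage α) (u : TimedWord α) (t : ℝ≥0)
    (a : α) : syntacticReset L (u ++ [(t, a)]) =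
      if IsRecognizable (residual (u ++ [(t, a)]) L) then 0 else syntacticReset L u + t := by
  simp [syntacticReset]

theorem syntacticReset_isResetFunction {α : Type u} (L : TimedLanguage α) :
    IsResetFunction (syntacticReset L) := by
  refine ⟨syntacticReset_nil L, fun u t a => ?_⟩
  rw [syntacticReset_snoc]
  split_ifs
  · exact Or.inl rfl
  · exact Or.inr rfl

/-- The normal form `N^R`: `N^R(ε) = ε` and `N^R(u(t·a)) = N^R(u)(t'·a)` where `t'` is the unique
half-integral delay with `R(u) + t ≡ hi(R(u)) + t'`, that is `t' = hi(R(u) + t) - hi(R(u))`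
(see `normalForm_delay_spec` and `normalForm_delay_unique`). -/
noncomputable def normalForm {α : Type u} (R : TimedWord α → ℝ≥0) (w : TimedWord α) :
    TimedWord α :=
  List.reverseRecOn (motive := fun _ => TimedWord α) w [] fun u x v =>
    v ++ [(hi (R u + x.1) - hi (R u), x.2)]

theorem normalForm_nil {α : Type u} (R : TimedWord α → ℝ≥0) : normalForm R [] = [] := by
  simp [normalForm]

theorem normalForm_snoc {α : Type u} (R : TimedWord α → ℝ≥0) (u : TimedWord α) (t : ℝ≥0)
    (a : α) : normalForm R (u ++ [(t, a)]) =
      normalForm R u ++ [(hi (R u + t) - hi (R u), a)] := by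
  simp [normalForm]

/-! ### Half-integral words and profiles -/

/-- Every delay is of the form `m / 2` with `m ∈ ℕ`. -/
def IsHalfIntegral {α : Type u} (w : TimedWord α) : Prop :=
  ∀ x ∈ w, ∃ m : ℕ, x.1 = (m : ℝ≥0) / 2

/-- The set of half-integral words. -/
abbrev HIWord (α : Type u) : Type u := {w : TimedWord α // IsHalfIntegral w}

/-- The half-integral word `u (n/2 · a)`. -/
noncomputable def HIWord.snoc {α : Type u} (w : HIWord α) (n : ℕ) (a : α) : HIWord α :=
  ⟨w.1 ++ [((n : ℝ≥0) / 2, a)], by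
    intro x hx
    rcases List.mem_append.1 hx with h | h
    · exact w.2 x h
    · exact ⟨n, by rw [List.mem_singleton.1 h]⟩⟩

/-- A profile `(R, ≈)`: a reset function and an equivalence relation on half-integral words. -/
structure Profile (α : Type u) : Type u where
  R : TimedWord α → ℝ≥0
  isReset : IsResetFunction R
  equiv : Setoid (HIWord α)

namespace Profile

variable {α : Type u}

/-- The proposition `C(K)`: if `R(u) + n/2 > K` then `u (n/2 · a) ≈ u (K + 1/2 · a)`
(note `K + 1/2 = (2K + 1)/2`). -/
def C (P : Profile α) (K : ℕ) : Prop :=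
  ∀ (w : HIWord α) (a : α) (n : ℕ), (K : ℝ≥0) < P.R w.1 + (n : ℝ≥0) / 2 →
    P.equiv (w.snoc n a) (w.snoc (2 * K + 1) a)

/-- The constant `K_(R,≈) ∈ ℕ ∪ {∞}`: the least `K` with `C(K)`, and `∞` if there is none. -/
noncomputable def constant (P : Profile α) : ℕ∞ := ⨅ K ∈ {K : ℕ | P.C K}, (K : ℕ∞)

/-- `L`-preserving profiles. -/
def Preserves (P : Profile α) (L : TimedLanguage α) : Prop :=
  (∀ v w : HIWord α, P.equiv v w → (v.1 ∈ L ↔ w.1 ∈ L)) ∧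
    ∀ w : TimedWord α, w ∈ L ↔ normalForm P.R w ∈ L

/-- Finite index: `≈` has finitely many classes and `K_(R,≈) < ∞`. -/
def FiniteIndex (P : Profile α) : Prop :=
  Finite (Quotient P.equiv) ∧ P.constant < ⊤

/-- Monotonic profiles. -/
def Monotonic (P : Profile α) : Prop :=
  (∀ v w : HIWord α, P.equiv v w →
    RegionEquivUpTo P.constant (P.R v.1) (P.R w.1) ∧
      ∀ (n : ℕ) (a : α), P.equiv (v.snoc n a) (w.snoc n a)) ∧
    ∀ w : TimedWord α, RegionEquiv (P.R w) (P.R (normalForm P.R w))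

end Profile

/-- The syntactic profile `(R^L, ≈^L)`: half-integral words are equivalent when they have the same
value under `R^L` and the same residual language. -/
noncomputable def syntacticProfile {α : Type u} (L : TimedLanguage α) : Profile α where
  R := syntacticReset L
  isReset := syntacticReset_isResetFunction L
  equiv :=
    { r := fun v w => syntacticReset L v.1 = syntacticReset L w.1 ∧
        residual v.1 L = residual w.1 L
      iseqv :=
        ⟨fun _ => ⟨rfl, rfl⟩, fun h => ⟨h.1.symm, h.2.symm⟩,
          fun h h' => ⟨h.1.trans h'.1, h.2.trans h'.2⟩⟩ }

/-! ### The delays of the normal form are the intended ones -/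

theorem frac_eq_zero_iff (x : ℝ≥0) : frac x = 0 ↔ x = (⌊x⌋₊ : ℝ≥0) := by
  unfold frac
  rw [tsub_eq_zero_iff_le]
  exact ⟨fun h => le_antisymm h (Nat.floor_le (zero_le (a := x))), fun h => h.le⟩

theorem hi_half_integral (x : ℝ≥0) : ∃ m : ℕ, hi x = (m : ℝ≥0) / 2 := by
  unfold hi
  split_ifs with h
  · refine ⟨2 * ⌊x⌋₊, ?_⟩
    rw [frac_eq_zero_iff] at h
    push_cast
    rw [← h]
    field_simp
  · refine ⟨2 * ⌊x⌋₊ + 1, ?_⟩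
    push_cast
    field_simp

theorem half_floor (n : ℕ) : ⌊(n : ℝ≥0) + 1 / 2⌋₊ = n := by
  rw [Nat.floor_eq_iff zero_le]
  constructor
  · exact le_self_add
  · gcongr
    rw [← NNReal.coe_lt_coe]
    push_cast
    norm_num

theorem hi_regionEquiv (x : ℝ≥0) : RegionEquiv x (hi x) := by
  unfold hi
  split_ifs with h
  · exact ⟨rfl, Iff.rfl⟩
  · refine ⟨(half_floor _).symm, ?_⟩
    refine iff_of_false h ?_
    rw [frac_eq_zero_iff, half_floor]
    simp

theorem hi_mono {x y : ℝ≥0} (hxy : x ≤ y) : hi x ≤ hi y := by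
  have hf : (⌊x⌋₊ : ℝ≥0) ≤ (⌊y⌋₊ : ℝ≥0) := by exact_mod_cast Nat.floor_mono hxy
  unfold hi
  split_ifs with h h' h'
  · exact hxy
  · rw [frac_eq_zero_iff] at h
    rw [h]
    exact hf.trans le_self_add
  · rw [frac_eq_zero_iff] at h h'
    have hlt : ⌊x⌋₊ < ⌊y⌋₊ := by
      rcases (Nat.floor_mono hxy).lt_or_eq with h1 | h1
      · exact h1
      · exfalso
        apply h
        apply le_antisymm _ (Nat.floor_le (zero_le (a := x)))
        rw [h1, ← h']
        exact hxy
    have h2 : (⌊x⌋₊ : ℝ≥0) + 1 ≤ (⌊y⌋₊ : ℝ≥0) := by exact_mod_cast hlt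
    rw [h']
    refine le_trans ?_ h2
    gcongr
    rw [← NNReal.coe_le_coe]
    push_cast
    norm_num
  · gcongr

/-- Two half-integral values in the same region are equal. -/
theorem half_integral_eq_of_regionEquiv {m n : ℕ}
    (h : RegionEquiv ((m : ℝ≥0) / 2) ((n : ℝ≥0) / 2)) : m = n := by
  obtain ⟨h1, h2⟩ := h
  have key : ∀ k : ℕ, ⌊(k : ℝ≥0) / 2⌋₊ = k / 2 := fun k => by
    have := Nat.floor_div_natCast (k : ℝ≥0) 2
    simpa using this
  have key2 : ∀ k : ℕ, frac ((k : ℝ≥0) / 2) = 0 ↔ k % 2 = 0 := fun k => by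
    rw [frac_eq_zero_iff, key, div_eq_iff (by norm_num)]
    constructor
    · intro h
      have : k = k / 2 * 2 := by exact_mod_cast h
      omega
    · intro h
      have : k = k / 2 * 2 := by omega
      exact_mod_cast this
  rw [key, key] at h1
  rw [key2, key2] at h2
  omega

/-- The delay used in `normalForm` is half-integral and satisfies the defining condition. -/
theorem normalForm_delay_spec (r t : ℝ≥0) :
    (∃ n : ℕ, hi (r + t) - hi r = (n : ℝ≥0) / 2) ∧
      RegionEquiv (r + t) (hi r + (hi (r + t) - hi r)) := by
  constructor
  · obtain ⟨m, hm⟩ := hi_half_integral r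
    obtain ⟨k, hk⟩ := hi_half_integral (r + t)
    have hle : m ≤ k := by
      have h := hi_mono (le_self_add : r ≤ r + t)
      rw [hm, hk] at h
      have h2 : (m : ℝ≥0) ≤ k := by
        rwa [div_le_div_iff_of_pos_right (by norm_num : (0 : ℝ≥0) < 2)] at h
      exact_mod_cast h2
    refine ⟨k - m, ?_⟩
    obtain ⟨d, rfl⟩ := Nat.exists_eq_add_of_le hle
    rw [hk, hm, Nat.add_sub_cancel_left]
    push_cast
    rw [add_div, add_tsub_cancel_left]
  · rw [add_tsub_cancel_of_le (hi_mono le_self_add)]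
    exact hi_regionEquiv _

/-- The delay used in `normalForm` is the only half-integral one satisfying the condition. -/
theorem normalForm_delay_unique (r t : ℝ≥0) (n : ℕ)
    (h : RegionEquiv (r + t) (hi r + (n : ℝ≥0) / 2)) :
    (n : ℝ≥0) / 2 = hi (r + t) - hi r := by
  obtain ⟨m, hm⟩ := hi_half_integral r
  obtain ⟨k, hk⟩ := hi_half_integral (r + t)
  have h0 := hi_regionEquiv (r + t)
  have h1 : RegionEquiv (((m + n : ℕ) : ℝ≥0) / 2) ((k : ℝ≥0) / 2) := by
    rw [← hk, Nat.cast_add, add_div, ← hm]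
    exact ⟨h.1.symm.trans h0.1, h.2.symm.trans h0.2⟩
  have h2 := half_integral_eq_of_regionEquiv h1
  rw [hk, ← h2, hm, Nat.cast_add, add_div, add_tsub_cancel_left]

end OneClock

/-!
Split the guards of a deterministic automaton into regions and complete it by a sink. The residual
of its language after a word is then the language of a configuration `(q, ν)`, and this residual is
recognizable if `ν = 0` or if `ν` exceeds the maximum constant.

The key point is that a recognizable residual `(q, ν)` depends only on `q` and the region of `ν`. If
`ν` and `μ` lie in the same region, there is an increasing time change commuting with `s ↦ s + 1`
which maps `0` to `0` and `ν` to `μ`. It identifies the behaviours of `(q, ν)` and `(q, μ)`, whereas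
an automaton recognizing the residual starts with clock value `0` and is blind to the time change.

Reading a word and its normal form side by side, the residuals are therefore either both
recognizable, hence equal, or neither is and they come from one state with region-equivalent clock
values; so the syntactic profile preserves `L` and is monotonic. As the syntactic reset function
stays below the clock of every deterministic automaton recognizing `L`, and resets whenever that
clock exceeds the maximum constant, its constant is at most `K_L`. Conversely, the classes of a
monotonic `L`-preserving profile of finite index are the states of an automaton recognizing `L`
whose maximum constant is at most the constant of the profile.
-/

namespace OneClock

/-! ### Region indices -/

/-- The index of the region of a clock value: `{c}` has index `2 * c` and `(c, c + 1)` has index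
`2 * c + 1`. -/
noncomputable def regionIndex (x : ℝ≥0) : ℕ := ⌊x⌋₊ + ⌈x⌉₊

theorem regionIndex_mono : Monotone regionIndex := fun _ _ h =>
  add_le_add (Nat.floor_mono h) (Nat.ceil_mono h)

theorem natCast_lt_iff_regionIndex {c : ℕ} {x : ℝ≥0} :
    (c : ℝ≥0) < x ↔ 2 * c < regionIndex x := by
  have h₁ := Nat.floor_le_ceil x
  have h₂ := Nat.ceil_le_floor_add_one x
  rw [← Nat.lt_ceil, regionIndex]
  omega

theorem lt_natCast_iff_regionIndex {c : ℕ} {x : ℝ≥0} :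
    x < (c : ℝ≥0) ↔ regionIndex x < 2 * c := by
  have h₁ := Nat.floor_le_ceil x
  have h₂ := Nat.ceil_le_floor_add_one x
  rw [← Nat.floor_lt zero_le, regionIndex]
  omega

theorem eq_natCast_iff_regionIndex {c : ℕ} {x : ℝ≥0} :
    x = (c : ℝ≥0) ↔ regionIndex x = 2 * c := by
  rw [eq_iff_le_not_lt, ← not_lt, natCast_lt_iff_regionIndex, lt_natCast_iff_regionIndex]
  omega

theorem regionIndex_eq_zero_iff {x : ℝ≥0} : regionIndex x = 0 ↔ x = 0 := by
  simpa using (eq_natCast_iff_regionIndex (c := 0) (x := x)).symm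

theorem regionIndex_eq_of_natCast_lt_iff {x y : ℝ≥0}
    (h₁ : ∀ c : ℕ, (c : ℝ≥0) < x ↔ (c : ℝ≥0) < y)
    (h₂ : ∀ c : ℕ, x < (c : ℝ≥0) ↔ y < (c : ℝ≥0)) : regionIndex x = regionIndex y := by
  simp only [natCast_lt_iff_regionIndex, lt_natCast_iff_regionIndex] at h₁ h₂
  have := h₁ (regionIndex x / 2)
  have := h₂ (regionIndex x / 2)
  have := h₂ (regionIndex x / 2 + 1)
  omega

theorem frac_eq_zero_iff_regionIndex {x : ℝ≥0} : frac x = 0 ↔ regionIndex x = 2 * ⌊x⌋₊ := by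
  rw [frac_eq_zero_iff, eq_natCast_iff_regionIndex]

theorem regionEquiv_iff_regionIndex {x y : ℝ≥0} :
    RegionEquiv x y ↔ regionIndex x = regionIndex y := by
  have hx₁ := Nat.floor_le_ceil x
  have hx₂ := Nat.ceil_le_floor_add_one x
  have hy₁ := Nat.floor_le_ceil y
  have hy₂ := Nat.ceil_le_floor_add_one y
  rw [RegionEquiv, frac_eq_zero_iff_regionIndex, frac_eq_zero_iff_regionIndex]
  simp only [regionIndex]
  omega

theorem regionEquivUpTo_natCast_iff {K : ℕ} {x y : ℝ≥0} :
    RegionEquivUpTo K x y ↔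
      min (regionIndex x) (2 * K + 1) = min (regionIndex y) (2 * K + 1) := by
  simp only [RegionEquivUpTo, regionEquiv_iff_regionIndex, Nat.cast_inj, exists_eq_left',
    natCast_lt_iff_regionIndex]
  omega

theorem hi_eq_regionIndex_div_two (x : ℝ≥0) : hi x = (regionIndex x : ℝ≥0) / 2 := by
  have h₁ := Nat.floor_le_ceil x
  have h₂ := Nat.ceil_le_floor_add_one x
  unfold hi
  split_ifs with h
  · rw [frac_eq_zero_iff_regionIndex.1 h, Nat.cast_mul, Nat.cast_ofNat,
      mul_div_cancel_left₀ _ two_ne_zero]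
    exact (frac_eq_zero_iff x).1 h
  · have : regionIndex x = 2 * ⌊x⌋₊ + 1 := by
      rw [frac_eq_zero_iff_regionIndex] at h
      unfold regionIndex at h ⊢
      omega
    rw [this]
    push_cast
    field_simp

theorem regionIndex_natCast_div_two (m : ℕ) : regionIndex ((m : ℝ≥0) / 2) = m := by
  have h := hi_regionEquiv ((m : ℝ≥0) / 2)
  rw [hi_eq_regionIndex_div_two] at h
  exact (half_integral_eq_of_regionEquiv h).symm

theorem regionIndex_hi (x : ℝ≥0) : regionIndex (hi x) = regionIndex x :=
  (regionEquiv_iff_regionIndex.1 (hi_regionEquiv x)).symm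

theorem hi_zero : hi 0 = 0 := by
  rw [hi_eq_regionIndex_div_two, regionIndex_eq_zero_iff.2 rfl, Nat.cast_zero, zero_div]

theorem natCast_sub_div_two {m n : ℕ} (h : m ≤ n) :
    ((n - m : ℕ) : ℝ≥0) / 2 = (n : ℝ≥0) / 2 - (m : ℝ≥0) / 2 := by
  obtain ⟨d, rfl⟩ := Nat.exists_eq_add_of_le h
  rw [Nat.add_sub_cancel_left, Nat.cast_add, add_div, add_tsub_cancel_left]

theorem natCast_lt_natCast_div_two_iff {K m : ℕ} : (K : ℝ≥0) < (m : ℝ≥0) / 2 ↔ 2 * K < m := by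
  rw [natCast_lt_iff_regionIndex, regionIndex_natCast_div_two]

/-! ### Guards -/

theorem ClockConstraint.mem_denote_congr {K : ℕ} {x y : ℝ≥0} (h : RegionEquivUpTo K x y)
    {φ : ClockConstraint} (hφ : φ.maxConst ≤ K) : x ∈ φ.denote ↔ y ∈ φ.denote := by
  rw [regionEquivUpTo_natCast_iff] at h
  induction φ with
  | gt c =>
    simp only [denote, maxConst, Set.mem_ofPred_eq, natCast_lt_iff_regionIndex] at *
    omega
  | eq c =>
    simp only [denote, maxConst, Set.mem_ofPred_eq, eq_natCast_iff_regionIndex] at *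
    omega
  | lt c =>
    simp only [denote, maxConst, Set.mem_ofPred_eq, lt_natCast_iff_regionIndex] at *
    omega
  | and φ ψ ihφ ihψ =>
    simp only [maxConst, max_le_iff] at hφ
    simp only [denote, Set.mem_inter_iff, ihφ hφ.1, ihψ hφ.2]

/-- The guard defining the region of index `i ≤ 2 * K`, and for `i = 2 * K + 1` the set of all
values above `K`. -/
def regionGuard (K i : ℕ) : ClockConstraint :=
  if i = 2 * K + 1 then .gt K
  else if i % 2 = 0 then .eq (i / 2) else .and (.gt (i / 2)) (.lt (i / 2 + 1))

theorem mem_denote_regionGuard {K i : ℕ} (hi : i < 2 * K + 2) {x : ℝ≥0} :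
    x ∈ (regionGuard K i).denote ↔ min (regionIndex x) (2 * K + 1) = i := by
  unfold regionGuard
  split_ifs <;>
    simp only [ClockConstraint.denote, Set.mem_ofPred_eq, Set.mem_inter_iff,
      natCast_lt_iff_regionIndex, lt_natCast_iff_regionIndex, eq_natCast_iff_regionIndex] <;>
    omega

theorem maxConst_regionGuard_le {K i : ℕ} (hi : i < 2 * K + 2) :
    (regionGuard K i).maxConst ≤ K := by
  unfold regionGuard
  split_ifs <;> simp only [ClockConstraint.maxConst] <;> omega

/-! ### Region machines -/

/-- A complete deterministic one-clock device: in the state `s`, a letter `a` read while the clock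
value lies in the region of index `i` leads to the state `(step s a i).1`, and resets the clock if
`(step s a i).2 = true`. Up to a bound on the constants, this is a one-clock deterministic timed
automaton whose guards have been split into regions and which has been completed by a sink. -/
structure RegionMachine (α : Type*) (S : Type*) where
  step : S → α → ℕ → S × Bool
  final : Set S

namespace RegionMachine

variable {α S T : Type*}

/-- The configuration reached from `c` by waiting for `x.1` and reading `x.2`. -/
noncomputable def move (M : RegionMachine α S) (c : S × ℝ≥0) (x : ℝ≥0 × α) : S × ℝ≥0 :=
  ((M.step c.1 x.2 (regionIndex (c.2 + x.1))).1,
    if (M.step c.1 x.2 (regionIndex (c.2 + x.1))).2 then 0 else c.2 + x.1)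

/-- The configuration reached from `c` by reading a timed word. -/
noncomputable def run (M : RegionMachine α S) (c : S × ℝ≥0) (w : TimedWord α) : S × ℝ≥0 :=
  w.foldl M.move c

/-- The language accepted from a configuration. -/
def language (M : RegionMachine α S) (c : S × ℝ≥0) : TimedLanguage α :=
  {w | (M.run c w).1 ∈ M.final}

/-- The behaviour does not distinguish clock values above `K`: all indices from `2 * K + 1` on are
treated alike. -/
def IsBounded (M : RegionMachine α S) (K : ℕ) : Prop :=
  ∀ s a i, M.step s a (min i (2 * K + 1)) = M.step s a i

variable {M : RegionMachine α S} {N : RegionMachine α T}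

theorem run_append (c : S × ℝ≥0) (u v : TimedWord α) :
    M.run c (u ++ v) = M.run (M.run c u) v :=
  List.foldl_append

theorem run_snoc (c : S × ℝ≥0) (w : TimedWord α) (x : ℝ≥0 × α) :
    M.run c (w ++ [x]) = M.move (M.run c w) x :=
  run_append c w [x]

theorem residual_language (c : S × ℝ≥0) (u : TimedWord α) :
    residual u (M.language c) = M.language (M.run c u) := by
  ext w
  simp only [residual, language, Set.mem_ofPred_eq, run_append]

theorem nil_mem_language {c : S × ℝ≥0} : [] ∈ M.language c ↔ c.1 ∈ M.final := Iff.rfl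

theorem cons_mem_language {c : S × ℝ≥0} {x : ℝ≥0 × α} {w : TimedWord α} :
    x :: w ∈ M.language c ↔ w ∈ M.language (M.move c x) := Iff.rfl

theorem language_eq_of_bisimulation (r : S × ℝ≥0 → T × ℝ≥0 → Prop)
    (hfinal : ∀ c d, r c d → (c.1 ∈ M.final ↔ d.1 ∈ N.final))
    (hmove : ∀ c d x, r c d → r (M.move c x) (N.move d x)) {c : S × ℝ≥0} {d : T × ℝ≥0}
    (h : r c d) : M.language c = N.language d :=
  Set.ext fun _ => hfinal _ _ (List.foldl_rel h fun x _ _ _ => hmove _ _ x)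

theorem IsBounded.step_congr {K : ℕ} (hM : M.IsBounded K) {x y : ℝ≥0}
    (h : RegionEquivUpTo K x y) (s : S) (a : α) :
    M.step s a (regionIndex x) = M.step s a (regionIndex y) := by
  rw [← hM s a (regionIndex x), regionEquivUpTo_natCast_iff.1 h, hM]

theorem isResetFunction_clock (M : RegionMachine α S) (s : S) :
    IsResetFunction fun w => (M.run (s, 0) w).2 := by
  refine ⟨rfl, fun w t a => ?_⟩
  simp only [run_snoc, move]
  split_ifs
  · exact Or.inl rfl
  · exact Or.inr rfl

/-- The machine `M` with its states renamed along a bijection. -/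
def reindex (M : RegionMachine α S) (e : S ≃ T) : RegionMachine α T where
  step s a i := Prod.map e id (M.step (e.symm s) a i)
  final := e.symm ⁻¹' M.final

theorem IsBounded.reindex {K : ℕ} (hM : M.IsBounded K) (e : S ≃ T) :
    (M.reindex e).IsBounded K := fun s a i => by
  simp only [RegionMachine.reindex, hM (e.symm s) a i]

theorem language_reindex (e : S ≃ T) (s : S) (ν : ℝ≥0) :
    (M.reindex e).language (e s, ν) = M.language (s, ν) := by
  refine language_eq_of_bisimulation (fun c d => c = (e d.1, d.2)) ?_ ?_ rfl
  · rintro _ d rfl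
    simp [reindex]
  · rintro _ d x rfl
    simp [reindex, move]

/-- The machine `M` started from an unknown clock value above `K`: the Boolean component records
that the clock of `M` has not been reset since, so that its value is still above `K`. -/
def aboveBound (M : RegionMachine α S) (K : ℕ) : RegionMachine α (S × Bool) where
  step p a i :=
    let d := M.step p.1 a (if p.2 then 2 * K + 1 else i)
    ((d.1, p.2 && !d.2), d.2)
  final := {p | p.1 ∈ M.final}

theorem IsBounded.aboveBound {K : ℕ} (hM : M.IsBounded K) : (M.aboveBound K).IsBounded K := by
  rintro ⟨s, _ | _⟩ a i
  · simp only [RegionMachine.aboveBound, Bool.false_eq_true, if_false, hM s a i]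
  · rfl

theorem IsBounded.language_aboveBound {K : ℕ} (hM : M.IsBounded K) (s : S) {ν : ℝ≥0}
    (hν : (K : ℝ≥0) < ν) (μ : ℝ≥0) :
    (M.aboveBound K).language ((s, true), μ) = M.language (s, ν) := by
  refine language_eq_of_bisimulation
    (fun c d => c.1.1 = d.1 ∧ if c.1.2 then (K : ℝ≥0) < d.2 else c.2 = d.2) ?_ ?_ ⟨rfl, hν⟩
  · rintro c d ⟨h, -⟩
    simp only [RegionMachine.aboveBound, Set.mem_ofPred_eq, h]
  · rintro ⟨⟨s, _ | _⟩, μ⟩ ⟨s', ν⟩ ⟨t, a⟩ ⟨rfl, h⟩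
    · obtain rfl : μ = ν := h
      simp [move, RegionMachine.aboveBound]
    · have hlt : (K : ℝ≥0) < ν + t := lt_add_of_lt_of_nonneg h zero_le
      have hstep : M.step s a (2 * K + 1) = M.step s a (regionIndex (ν + t)) := by
        rw [← hM s a (regionIndex (ν + t)),
          min_eq_right (natCast_lt_iff_regionIndex.1 hlt)]
      cases hreset : (M.step s a (regionIndex (ν + t))).2 <;>
        simp [move, RegionMachine.aboveBound, hstep, hreset, hlt]

theorem IsBounded.language_eq_of_lt {K : ℕ} (hM : M.IsBounded K) (s : S) {ν μ : ℝ≥0}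
    (hν : (K : ℝ≥0) < ν) (hμ : (K : ℝ≥0) < μ) : M.language (s, ν) = M.language (s, μ) := by
  rw [← hM.language_aboveBound s hν 0, hM.language_aboveBound s hμ 0]

end RegionMachine

/-! ### Region machines and automata -/

/-- The letters occurring in the words of a timed language. -/
def letters {α : Type*} (L : TimedLanguage α) : Set α := {a | ∃ w ∈ L, ∃ x ∈ w, x.2 = a}

namespace OneTA

variable {α : Type*}

/-- The transitions reading `a` that are enabled in the state `q` at the clock value `x`. -/
def enabled (A : OneTA α) (q : A.State) (a : α) (x : ℝ≥0) : Set (Transition α A.State) :=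
  {θ | θ ∈ A.trans ∧ θ.source = q ∧ θ.letter = a ∧ x ∈ θ.guard.denote}

open Classical in
/-- The region machine of an automaton, where `none` is a rejecting sink. Regions are represented
by their half-integral points, and some enabled transition is chosen if there are several. -/
noncomputable def regionMachine (A : OneTA α) : RegionMachine α (Option A.State) where
  step s a i := s.elim (none, true) fun q =>
    if h : (A.enabled q a ((i : ℝ≥0) / 2)).Nonempty then (some h.choose.target, h.choose.reset)
    else (none, true)
  final := some '' A.final

variable {A : OneTA α}

theorem nil_mem_languageFrom {q : A.State} {ν : ℝ≥0} :
    [] ∈ A.languageFrom q ν ↔ q ∈ A.final := by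
  simp [languageFrom, Reaches]

theorem cons_mem_languageFrom {q : A.State} {ν t : ℝ≥0} {a : α} {w : TimedWord α} :
    (t, a) :: w ∈ A.languageFrom q ν ↔ ∃ θ ∈ A.enabled q a (ν + t),
      w ∈ A.languageFrom θ.target (if θ.reset then 0 else ν + t) := by
  constructor
  · rintro ⟨q', ν', ⟨θ, hθ, hsource, hletter, hguard, hrun⟩, hfinal⟩
    exact ⟨θ, ⟨hθ, hsource, hletter, hguard⟩, q', ν', hrun, hfinal⟩
  · rintro ⟨θ, ⟨hθ, hsource, hletter, hguard⟩, q', ν', hrun, hfinal⟩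
    exact ⟨q', ν', ⟨θ, hθ, hsource, hletter, hguard, hrun⟩, hfinal⟩

theorem enabled_congr {x y : ℝ≥0} (h : RegionEquivUpTo A.maxConst x y) (q : A.State) (a : α) :
    A.enabled q a x = A.enabled q a y :=
  Set.ext fun _ => and_congr_right fun hθ => and_congr_right fun _ => and_congr_right fun _ =>
    ClockConstraint.mem_denote_congr h
      (Finset.le_sup (f := fun θ : Transition α A.State => θ.guard.maxConst) hθ)

theorem regionMachine_isBounded (A : OneTA α) : A.regionMachine.IsBounded A.maxConst := by
  rintro (_ | q) a i
  · rfl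
  · have h : RegionEquivUpTo A.maxConst (((min i (2 * A.maxConst + 1) : ℕ) : ℝ≥0) / 2)
        ((i : ℝ≥0) / 2) := by
      rw [regionEquivUpTo_natCast_iff, regionIndex_natCast_div_two, regionIndex_natCast_div_two]
      omega
    dsimp only [regionMachine, Option.elim]
    rw [enabled_congr h]

theorem enabled_regionIndex_div_two (q : A.State) (a : α) (x : ℝ≥0) :
    A.enabled q a ((regionIndex x : ℝ≥0) / 2) = A.enabled q a x :=
  enabled_congr (Or.inl (regionEquiv_iff_regionIndex.2 (regionIndex_natCast_div_two _))) q a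

theorem regionMachine_step_of_enabled_eq_empty {q : A.State} {a : α} {x : ℝ≥0}
    (h : A.enabled q a x = ∅) :
    A.regionMachine.step (some q) a (regionIndex x) = (none, true) := by
  simp [regionMachine, enabled_regionIndex_div_two, h]

theorem Deterministic.enabled_subsingleton (hA : A.Deterministic) (q : A.State) (a : α)
    (x : ℝ≥0) : (A.enabled q a x).Subsingleton := by
  rintro θ ⟨hθ, hsource, hletter, hguard⟩ θ' ⟨hθ', hsource', hletter', hguard'⟩
  by_contra hne
  rcases hA θ hθ θ' hθ' hne with h | h | h
  · exact h (hsource.trans hsource'.symm)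
  · exact h (hletter.trans hletter'.symm)
  · exact (h.subset ⟨hguard, hguard'⟩ : x ∈ (∅ : Set ℝ≥0))

theorem Deterministic.regionMachine_step (hA : A.Deterministic) {q : A.State} {a : α} {x : ℝ≥0}
    {θ : Transition α A.State} (hθ : θ ∈ A.enabled q a x) :
    A.regionMachine.step (some q) a (regionIndex x) = (some θ.target, θ.reset) := by
  have h : (A.enabled q a x).Nonempty := ⟨θ, hθ⟩
  obtain rfl := hA.enabled_subsingleton q a x hθ h.choose_spec
  simp [regionMachine, enabled_regionIndex_div_two, h]

theorem regionMachine_language_none (ν : ℝ≥0) : A.regionMachine.language (none, ν) = ∅ := by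
  refine Set.eq_empty_of_forall_notMem fun w => ?_
  induction w generalizing ν with
  | nil => simp [RegionMachine.nil_mem_language, regionMachine]
  | cons _ _ ih => exact ih _

theorem Deterministic.regionMachine_language_some (hA : A.Deterministic) (q : A.State)
    (ν : ℝ≥0) : A.regionMachine.language (some q, ν) = A.languageFrom q ν := by
  ext w
  induction w generalizing q ν with
  | nil => simp [RegionMachine.nil_mem_language, nil_mem_languageFrom, regionMachine]
  | cons x w ih =>
    obtain ⟨t, a⟩ := x
    rw [RegionMachine.cons_mem_language, cons_mem_languageFrom]
    rcases (A.enabled q a (ν + t)).eq_empty_or_nonempty with h | ⟨θ, hθ⟩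
    · simp [RegionMachine.move, regionMachine_step_of_enabled_eq_empty h,
        regionMachine_language_none, h]
    · rw [(hA.enabled_subsingleton q a (ν + t)).eq_singleton_of_mem hθ]
      simp only [RegionMachine.move, hA.regionMachine_step hθ, ih, Set.mem_singleton_iff,
        exists_eq_left]

theorem Deterministic.residual_language (hA : A.Deterministic) (w : TimedWord α) :
    residual w A.language =
      A.regionMachine.language (A.regionMachine.run (some A.init, 0) w) := by
  rw [language, ← hA.regionMachine_language_some, RegionMachine.residual_language]

theorem letters_languageFrom_subset (A : OneTA α) (q : A.State) (ν : ℝ≥0) :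
    letters (A.languageFrom q ν) ⊆ Transition.letter '' (A.trans : Set (Transition α A.State)) := by
  rintro a ⟨w, hw, x, hx, rfl⟩
  induction w generalizing q ν with
  | nil => cases hx
  | cons y w ih =>
    obtain ⟨θ, ⟨hθ, -, hletter, -⟩, hw⟩ := cons_mem_languageFrom.1 hw
    rcases List.mem_cons.1 hx with rfl | hx
    · exact ⟨θ, hθ, hletter⟩
    · exact ih _ _ hw hx

theorem Deterministic.finite_letters_regionMachine_language (hA : A.Deterministic)
    (c : Option A.State × ℝ≥0) : (letters (A.regionMachine.language c)).Finite := by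
  obtain ⟨_ | q, ν⟩ := c
  · simp [regionMachine_language_none, letters]
  · rw [hA.regionMachine_language_some]
    exact (A.trans.finite_toSet.image _).subset (A.letters_languageFrom_subset q ν)

end OneTA

namespace RegionMachine

variable {α S : Type*} {Q : Type}

/-- The transition of `toAutomaton` from the state `i.1` reading `i.2.1` in the region of index
`i.2.2`. -/
def toTransition (M : RegionMachine α Q) (K : ℕ) (Γ : Set α) (i : Q × Γ × Fin (2 * K + 2)) :
    Transition α Q where
  source := i.1
  target := (M.step i.1 i.2.1 i.2.2).1
  letter := i.2.1
  guard := regionGuard K i.2.2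
  reset := (M.step i.1 i.2.1 i.2.2).2

/-- The automaton that behaves on the letters in `Γ` like the machine `M` started in `s₀`, provided
that `M` is bounded by `K`. It has no transitions reading other letters. -/
noncomputable abbrev toAutomaton [Finite Q] (M : RegionMachine α Q) (K : ℕ) (Γ : Set α) [Finite Γ]
    (s₀ : Q) : OneTA α where
  State := Q
  finite_state := inferInstance
  init := s₀
  trans := (Set.finite_range (M.toTransition K Γ)).toFinset
  final := M.final

section

variable [Finite Q] {M : RegionMachine α Q} {K : ℕ} {Γ : Set α} [Finite Γ] {s₀ : Q}

theorem mem_enabled_toAutomaton {s : Q} {a : α} {x : ℝ≥0} {θ : Transition α Q} :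
    θ ∈ (M.toAutomaton K Γ s₀).enabled s a x ↔ ∃ ha : a ∈ Γ,
      θ = M.toTransition K Γ (s, ⟨a, ha⟩, ⟨min (regionIndex x) (2 * K + 1), by omega⟩) := by
  simp only [OneTA.enabled, Set.Finite.mem_toFinset, Set.mem_range, Set.mem_ofPred_eq]
  constructor
  · rintro ⟨⟨⟨s, a, i⟩, rfl⟩, rfl, rfl, hguard⟩
    obtain rfl : ⟨_, by omega⟩ = i := Fin.ext ((mem_denote_regionGuard i.2).1 hguard)
    exact ⟨a.2, rfl⟩
  · rintro ⟨ha, rfl⟩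
    exact ⟨⟨_, rfl⟩, rfl, rfl, (mem_denote_regionGuard (by omega)).2 rfl⟩

theorem toAutomaton_deterministic : (M.toAutomaton K Γ s₀).Deterministic := by
  intro θ hθ θ' hθ' hne
  by_contra! h
  obtain ⟨hsource, hletter, x, hguard, hguard'⟩ := h
  obtain ⟨_, hθ_eq⟩ := mem_enabled_toAutomaton.1 ⟨hθ, rfl, rfl, hguard⟩
  obtain ⟨_, hθ'_eq⟩ := mem_enabled_toAutomaton.1 ⟨hθ', hsource.symm, hletter.symm, hguard'⟩
  exact hne (hθ_eq.trans hθ'_eq.symm)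

theorem maxConst_toAutomaton_le : (M.toAutomaton K Γ s₀).maxConst ≤ K := by
  refine Finset.sup_le fun θ hθ => ?_
  obtain ⟨i, rfl⟩ := (Set.Finite.mem_toFinset _).1 hθ
  exact maxConst_regionGuard_le i.2.2.2

theorem IsBounded.languageFrom_toAutomaton (hM : M.IsBounded K) (s : Q) (ν : ℝ≥0) :
    (M.toAutomaton K Γ s₀).languageFrom s ν = {w ∈ M.language (s, ν) | ∀ x ∈ w, x.2 ∈ Γ} := by
  ext w
  induction w generalizing s ν with
  | nil => simp [OneTA.nil_mem_languageFrom, nil_mem_language]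
  | cons x w ih =>
    obtain ⟨t, a⟩ := x
    have hstep := hM s a (regionIndex (ν + t))
    rw [OneTA.cons_mem_languageFrom, Set.mem_ofPred_eq, cons_mem_language, List.forall_mem_cons]
    constructor
    · rintro ⟨θ, hθ, hw⟩
      obtain ⟨ha, rfl⟩ := mem_enabled_toAutomaton.1 hθ
      simp only [toTransition, hstep, ih] at hw
      exact ⟨hw.1, ha, hw.2⟩
    · rintro ⟨hw, ha, hΓ⟩
      refine ⟨_, mem_enabled_toAutomaton.2 ⟨ha, rfl⟩, ?_⟩
      simp only [toTransition, hstep, ih]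
      exact ⟨hw, hΓ⟩

end

theorem IsBounded.exists_automaton [Finite S] {M : RegionMachine α S} {K : ℕ}
    (hM : M.IsBounded K) {s : S} (hfin : (letters (M.language (s, 0))).Finite) :
    ∃ A : OneTA α, A.Deterministic ∧ A.maxConst ≤ K ∧ A.language = M.language (s, 0) := by
  obtain ⟨n, ⟨e⟩⟩ := Finite.exists_equiv_fin S
  have := hfin.to_subtype
  refine ⟨(M.reindex e).toAutomaton K (letters (M.language (s, 0))) (e s),
    toAutomaton_deterministic, maxConst_toAutomaton_le, ?_⟩
  rw [OneTA.language, (hM.reindex e).languageFrom_toAutomaton, language_reindex]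
  exact Set.sep_eq_self_iff_mem_true.2 fun w hw x hx => ⟨w, hw, x, hx, rfl⟩

theorem IsBounded.isRecognizable_language_zero [Finite S] {M : RegionMachine α S} {K : ℕ}
    (hM : M.IsBounded K) {s : S} (hfin : (letters (M.language (s, 0))).Finite) :
    IsRecognizable (M.language (s, 0)) := by
  obtain ⟨A, hA, -, hlang⟩ := hM.exists_automaton hfin
  exact ⟨A, hA, hlang⟩

theorem IsBounded.isRecognizable_language_of_lt [Finite S] {M : RegionMachine α S} {K : ℕ}
    (hM : M.IsBounded K) {s : S} {ν : ℝ≥0} (hν : (K : ℝ≥0) < ν)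
    (hfin : (letters (M.language (s, ν))).Finite) : IsRecognizable (M.language (s, ν)) := by
  rw [← hM.language_aboveBound s hν 0] at hfin ⊢
  exact hM.aboveBound.isRecognizable_language_zero hfin

end RegionMachine

namespace OneTA.Deterministic

variable {α : Type*} {A : OneTA α}

theorem isRecognizable_language_zero (hA : A.Deterministic) (q : Option A.State) :
    IsRecognizable (A.regionMachine.language (q, 0)) :=
  have := A.finite_state
  A.regionMachine_isBounded.isRecognizable_language_zero
    (hA.finite_letters_regionMachine_language _)

theorem isRecognizable_language_of_lt (hA : A.Deterministic) (q : Option A.State) {ν : ℝ≥0}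
    (hν : (A.maxConst : ℝ≥0) < ν) : IsRecognizable (A.regionMachine.language (q, ν)) :=
  have := A.finite_state
  A.regionMachine_isBounded.isRecognizable_language_of_lt hν
    (hA.finite_letters_regionMachine_language _)

end OneTA.Deterministic

theorem IsRecognizable.finite_letters {α : Type*} {L : TimedLanguage α} (hL : IsRecognizable L) :
    (letters L).Finite := by
  obtain ⟨A, -, rfl⟩ := hL
  exact (A.trans.finite_toSet.image _).subset (A.letters_languageFrom_subset _ _)


/-! ### Time warps -/

theorem strictMono_floor_add_fract_rpow {p : ℝ} (hp : 0 < p) :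
    StrictMono fun s : ℝ => ⌊s⌋ + Int.fract s ^ p := by
  intro s t hst
  rcases (Int.floor_mono hst.le).lt_or_eq with hfloor | hfloor
  · have hle : (⌊s⌋ : ℝ) + 1 ≤ ⌊t⌋ := by exact_mod_cast hfloor
    have hs := Real.rpow_lt_one (Int.fract_nonneg s) (Int.fract_lt_one s) hp
    have ht := Real.rpow_nonneg (Int.fract_nonneg t) p
    dsimp only
    linarith
  · have hfract : Int.fract s < Int.fract t := by
      rw [Int.fract, Int.fract, hfloor]
      exact sub_lt_sub_right hst _
    simpa only [hfloor, add_lt_add_iff_left] using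
      Real.rpow_lt_rpow (Int.fract_nonneg s) hfract hp

/-- The time change fixing the integers and raising fractional parts to the power `p`. A suitable
`p` moves a given non-integral number to any other one with the same integral part. -/
noncomputable def fractPow (p : ℝ) (hp : 0 < p) : CircleDeg1Lift where
  toFun s := ⌊s⌋ + Int.fract s ^ p
  monotone' := (strictMono_floor_add_fract_rpow hp).monotone
  map_add_one' s := by simp only [Int.floor_add_one, Int.fract_add_one]; push_cast; ring

theorem exists_rpow_eq {b c : ℝ} (hb : b ∈ Set.Ioo 0 1) (hc : c ∈ Set.Ioo 0 1) :
    ∃ p : ℝ, 0 < p ∧ b ^ p = c :=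
  ⟨Real.logb b c, Real.logb_pos_of_base_lt_one hb.1 hb.2 hc.1 hc.2,
    Real.rpow_logb hb.1 hb.2.ne hc.1⟩

theorem exists_circleDeg1Lift_of_regionIndex_eq {x y : ℝ≥0} (h : regionIndex x = regionIndex y) :
    ∃ f : CircleDeg1Lift, StrictMono f ∧ f 0 = 0 ∧ f x = y := by
  obtain ⟨hfloor, hfrac⟩ := regionEquiv_iff_regionIndex.2 h
  by_cases hx : frac x = 0
  · have hxy : x = y := by
      rw [(frac_eq_zero_iff x).1 hx, (frac_eq_zero_iff y).1 (hfrac.1 hx), hfloor]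
    exact ⟨1, strictMono_id, rfl, congrArg NNReal.toReal hxy⟩
  · have hcast (z : ℝ≥0) : (⌊(z : ℝ)⌋ : ℝ) = (⌊z⌋₊ : ℝ) :=
      (natCast_floor_eq_intCast_floor z.coe_nonneg).symm
    have hmem (z : ℝ≥0) (hz : frac z ≠ 0) : Int.fract (z : ℝ) ∈ Set.Ioo (0 : ℝ) 1 := by
      refine ⟨(Int.fract_nonneg _).lt_of_ne' fun h0 => hz ?_, Int.fract_lt_one _⟩
      rw [Int.fract, hcast, sub_eq_zero] at h0
      exact (frac_eq_zero_iff z).2 (NNReal.eq h0)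
    obtain ⟨p, hp, hpow⟩ := exists_rpow_eq (hmem x hx) (hmem y (hfrac.not.1 hx))
    refine ⟨fractPow p hp, strictMono_floor_add_fract_rpow hp, ?_, ?_⟩
    · simp [fractPow, Real.zero_rpow hp.ne']
    · change (⌊(x : ℝ)⌋ : ℝ) + Int.fract (x : ℝ) ^ p = y
      rw [hpow, hcast, hfloor, ← hcast, Int.floor_add_fract]

/-- The image of a timed word, started at the absolute time `τ`, under the time change `f`. -/
noncomputable def warpWord {α : Type*} (f : CircleDeg1Lift) : ℝ → TimedWord α → TimedWord α
  | _, [] => []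
  | τ, (t, a) :: w => ((f (τ + t) - f τ).toNNReal, a) :: warpWord f (τ + t) w

theorem coe_warped_delay (f : CircleDeg1Lift) (τ : ℝ) (t : ℝ≥0) :
    ((f (τ + t) - f τ).toNNReal : ℝ) = f (τ + t) - f τ :=
  Real.coe_toNNReal _ (sub_nonneg.2 (f.monotone (le_add_of_nonneg_right t.2)))

/-- The clock was last reset at the time `τ - x`, so both clock values compare to a natural number
`c` as the warped times `f (τ + t)` and `f (τ - x + c) = f (τ - x) + c`. -/
theorem regionIndex_add_warp {f : CircleDeg1Lift} (hf : StrictMono f) {τ : ℝ} {x y : ℝ≥0}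
    (h : f (τ - x) = f τ - y) (t : ℝ≥0) :
    regionIndex (y + (f (τ + t) - f τ).toNNReal) = regionIndex (x + t) := by
  have hshift (c : ℕ) : f (τ - x + c) = f τ - y + c := by rw [f.map_add_nat, h]
  refine regionIndex_eq_of_natCast_lt_iff (fun c => ?_) fun c => ?_ <;>
    rw [← NNReal.coe_lt_coe, ← NNReal.coe_lt_coe, NNReal.coe_add, NNReal.coe_add,
      coe_warped_delay, NNReal.coe_natCast]
  · calc (c : ℝ) < y + (f (τ + t) - f τ) ↔ f (τ - x + c) < f (τ + t) := by
          rw [hshift]; constructor <;> intro h <;> linarith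
      _ ↔ (c : ℝ) < x + t := by
          rw [hf.lt_iff_lt]; constructor <;> intro h <;> linarith
  · calc (y + (f (τ + t) - f τ) : ℝ) < c ↔ f (τ + t) < f (τ - x + c) := by
          rw [hshift]; constructor <;> intro h <;> linarith
      _ ↔ (x + t : ℝ) < c := by
          rw [hf.lt_iff_lt]; constructor <;> intro h <;> linarith

namespace RegionMachine

variable {α S : Type*}

theorem warpWord_mem_language (M : RegionMachine α S) {f : CircleDeg1Lift} (hf : StrictMono f)
    {τ : ℝ} {x y : ℝ≥0} (h : f (τ - x) = f τ - y) (s : S) (w : TimedWord α) :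
    warpWord f τ w ∈ M.language (s, y) ↔ w ∈ M.language (s, x) := by
  induction w generalizing τ x y s with
  | nil => exact Iff.rfl
  | cons z w ih =>
    obtain ⟨t, a⟩ := z
    simp only [warpWord, cons_mem_language, move, regionIndex_add_warp hf h]
    split_ifs
    · exact ih (by simp) _
    · refine ih ?_ _
      rw [NNReal.coe_add, NNReal.coe_add, coe_warped_delay, add_sub_add_right_eq_sub, h]
      ring

/-- An automaton recognizing the language of `(s, x)` starts with clock value `0`, hence does not
notice a time warp that moves `x` to `y`. -/
theorem language_eq_of_isRecognizable (M : RegionMachine α S) {s : S} {x y : ℝ≥0}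
    (h : regionIndex x = regionIndex y) (hrec : IsRecognizable (M.language (s, x))) :
    M.language (s, y) = M.language (s, x) := by
  obtain ⟨B, hB, hlang⟩ := hrec
  obtain ⟨f, hf, hf₀, hfy⟩ := exists_circleDeg1Lift_of_regionIndex_eq h.symm
  rw [OneTA.language, ← hB.regionMachine_language_some] at hlang
  ext w
  calc w ∈ M.language (s, y) ↔ warpWord f y w ∈ M.language (s, x) :=
        (M.warpWord_mem_language hf (by rw [sub_self, hf₀, hfy, sub_self]) s w).symm
    _ ↔ warpWord f y w ∈ B.regionMachine.language (some B.init, 0) := by rw [hlang]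
    _ ↔ w ∈ B.regionMachine.language (some B.init, 0) :=
        B.regionMachine.warpWord_mem_language hf (by simp) _ w
    _ ↔ w ∈ M.language (s, x) := by rw [hlang]

theorem isRecognizable_language_congr (M : RegionMachine α S) {s : S} {x y : ℝ≥0}
    (h : regionIndex x = regionIndex y) :
    IsRecognizable (M.language (s, x)) ↔ IsRecognizable (M.language (s, y)) :=
  ⟨fun hrec => M.language_eq_of_isRecognizable h hrec ▸ hrec,
    fun hrec => M.language_eq_of_isRecognizable h.symm hrec ▸ hrec⟩

end RegionMachine

/-! ### Normal forms and the syntactic reset function -/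

section

variable {α : Type*} {L L₁ L₂ : TimedLanguage α} {x y t t' : ℝ≥0}

theorem residual_append (u v : TimedWord α) :
    residual (u ++ v) L = residual v (residual u L) := by
  ext w
  simp only [residual, Set.mem_ofPred_eq, List.append_assoc]

theorem nil_mem_residual {w : TimedWord α} : [] ∈ residual w L ↔ w ∈ L := by
  simp only [residual, Set.mem_ofPred_eq, List.append_nil]

theorem syntacticReset_eq_zero {w : TimedWord α} (h : IsRecognizable (residual w L)) :
    syntacticReset L w = 0 := by
  rcases List.eq_nil_or_concat' w with rfl | ⟨u, ⟨t, a⟩, rfl⟩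
  · exact syntacticReset_nil L
  · rw [syntacticReset_snoc, if_pos h]

/-- `L₁` and `L₂` are the languages accepted from one state of some deterministic automaton, with
clock values `x` and `y` respectively. The residuals of a recognizable language after a word and
after its normal form are related in this way. The automaton is existentially quantified because
it is replaced whenever a residual becomes recognizable. -/
def SharesState (L₁ : TimedLanguage α) (x : ℝ≥0) (L₂ : TimedLanguage α) (y : ℝ≥0) : Prop :=
  ∃ A : OneTA α, A.Deterministic ∧ ∃ q,
    L₁ = A.regionMachine.language (q, x) ∧ L₂ = A.regionMachine.language (q, y)

theorem IsRecognizable.sharesState (hL : IsRecognizable L) : SharesState L 0 L 0 := by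
  obtain ⟨A, hA, rfl⟩ := hL
  exact ⟨A, hA, some A.init, (hA.regionMachine_language_some _ _).symm,
    (hA.regionMachine_language_some _ _).symm⟩

theorem SharesState.nil_mem_iff (h : SharesState L₁ x L₂ y) : [] ∈ L₁ ↔ [] ∈ L₂ := by
  obtain ⟨A, -, q, rfl, rfl⟩ := h
  rfl

theorem SharesState.residual_singleton (h : SharesState L₁ x L₂ y)
    (hregion : regionIndex (x + t) = regionIndex (y + t')) (a : α) :
    (IsRecognizable (residual [(t, a)] L₁) ∧ residual [(t', a)] L₂ = residual [(t, a)] L₁) ∨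
      ¬IsRecognizable (residual [(t, a)] L₁) ∧ ¬IsRecognizable (residual [(t', a)] L₂) ∧
        SharesState (residual [(t, a)] L₁) (x + t) (residual [(t', a)] L₂) (y + t') := by
  obtain ⟨A, hA, q, rfl, rfl⟩ := h
  simp only [RegionMachine.residual_language, RegionMachine.run, List.foldl_cons, List.foldl_nil,
    RegionMachine.move, hregion]
  split_ifs
  · exact Or.inl ⟨hA.isRecognizable_language_zero _, rfl⟩
  · refine or_iff_not_imp_left.2 fun hrec => ?_
    have hnot : ¬IsRecognizable (A.regionMachine.language (_, x + t)) := fun h =>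
      hrec ⟨h, A.regionMachine.language_eq_of_isRecognizable hregion h⟩
    exact ⟨hnot, (A.regionMachine.isRecognizable_language_congr hregion).not.1 hnot, A, hA, _,
      rfl, rfl⟩

theorem sharesState_residual_normalForm (hL : IsRecognizable L) (w : TimedWord α) :
    SharesState (residual w L) (syntacticReset L w)
      (residual (normalForm (syntacticReset L) w) L) (hi (syntacticReset L w)) ∧
    syntacticReset L (normalForm (syntacticReset L) w) = hi (syntacticReset L w) := by
  induction w using List.reverseRecOn with
  | nil =>
    simp only [normalForm_nil, syntacticReset_nil, hi_zero]
    exact ⟨hL.sharesState, trivial⟩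
  | append_singleton w z ih =>
    obtain ⟨t, a⟩ := z
    obtain ⟨hshare, hreset⟩ := ih
    have hdelay := add_tsub_cancel_of_le
      (hi_mono (le_self_add : syntacticReset L w ≤ syntacticReset L w + t))
    have hregion := (regionIndex_hi (syntacticReset L w + t)).symm
    rw [← hdelay] at hregion
    have hstep := hshare.residual_singleton hregion a
    simp only [← residual_append, hdelay] at hstep
    rw [normalForm_snoc, syntacticReset_snoc, syntacticReset_snoc, hreset, hdelay]
    rcases hstep with ⟨hrec, heq⟩ | ⟨hnot, hnot', hshare'⟩
    · rw [heq, if_pos hrec, if_pos hrec, hi_zero]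
      exact ⟨hrec.sharesState, rfl⟩
    · rw [if_neg hnot, if_neg hnot']
      exact ⟨hshare', rfl⟩

theorem mem_normalForm_syntacticReset_iff (hL : IsRecognizable L) (w : TimedWord α) :
    normalForm (syntacticReset L) w ∈ L ↔ w ∈ L := by
  rw [← nil_mem_residual, ← nil_mem_residual (w := w)]
  exact (sharesState_residual_normalForm hL w).1.nil_mem_iff.symm

theorem syntacticProfile_equiv_snoc {v w : HIWord α} (h : (syntacticProfile L).equiv v w) (n : ℕ)
    (a : α) : (syntacticProfile L).equiv (v.snoc n a) (w.snoc n a) := by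
  obtain ⟨hreset, hresidual⟩ := h
  have hresidual' : residual (v.snoc n a).1 L = residual (w.snoc n a).1 L := by
    simp only [HIWord.snoc, residual_append, hresidual]
  refine ⟨?_, hresidual'⟩
  simp only [HIWord.snoc, syntacticReset_snoc] at hresidual' ⊢
  rw [hresidual', hreset]

theorem syntacticProfile_preserves (hL : IsRecognizable L) :
    (syntacticProfile L).Preserves L := by
  refine ⟨fun v w h => ?_, fun w => (mem_normalForm_syntacticReset_iff hL w).symm⟩
  rw [← nil_mem_residual, h.2, nil_mem_residual]

theorem syntacticProfile_monotonic (hL : IsRecognizable L) :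
    (syntacticProfile L).Monotonic := by
  refine ⟨fun v w h => ⟨Or.inl ?_, syntacticProfile_equiv_snoc h⟩, fun w => ?_⟩
  · rw [regionEquiv_iff_regionIndex]
    exact congrArg regionIndex h.1
  · change RegionEquiv (syntacticReset L w) (syntacticReset L (normalForm (syntacticReset L) w))
    rw [(sharesState_residual_normalForm hL w).2]
    exact hi_regionEquiv _

end

/-! ### Half-integral words -/

section

variable {α : Type*} {R : TimedWord α → ℝ≥0}

theorem IsResetFunction.exists_natCast_div_two (hR : IsResetFunction R) {w : TimedWord α}
    (hw : IsHalfIntegral w) : ∃ m : ℕ, R w = (m : ℝ≥0) / 2 := by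
  induction w using List.reverseRecOn with
  | nil => exact ⟨0, by rw [hR.1, Nat.cast_zero, zero_div]⟩
  | append_singleton w z ih =>
    obtain ⟨m, hm⟩ := ih fun y hy => hw y (List.mem_append_left _ hy)
    obtain ⟨n, hn⟩ := hw z (List.mem_append_right _ (List.mem_singleton_self z))
    rcases hR.2 w z.1 z.2 with h | h
    · exact ⟨0, by rw [h, Nat.cast_zero, zero_div]⟩
    · exact ⟨m + n, by rw [h, hm, hn, Nat.cast_add, add_div]⟩

theorem isHalfIntegral_normalForm (R : TimedWord α → ℝ≥0) (w : TimedWord α) :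
    IsHalfIntegral (normalForm R w) := by
  induction w using List.reverseRecOn with
  | nil => simp [normalForm_nil, IsHalfIntegral]
  | append_singleton w z ih =>
    rw [normalForm_snoc]
    intro y hy
    rcases List.mem_append.1 hy with hy | hy
    · exact ih y hy
    · rw [List.mem_singleton.1 hy]
      exact (normalForm_delay_spec _ _).1

/-- The normal form of a timed word as a half-integral word. -/
noncomputable def normalFormHI (R : TimedWord α → ℝ≥0) (w : TimedWord α) : HIWord α :=
  ⟨normalForm R w, isHalfIntegral_normalForm R w⟩

theorem normalFormHI_snoc (w : TimedWord α) (t : ℝ≥0) (a : α) :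
    normalFormHI R (w ++ [(t, a)]) =
      (normalFormHI R w).snoc (regionIndex (R w + t) - regionIndex (R w)) a := by
  apply Subtype.ext
  simp only [normalFormHI, HIWord.snoc, normalForm_snoc,
    natCast_sub_div_two (regionIndex_mono (le_self_add : R w ≤ R w + t)),
    hi_eq_regionIndex_div_two]

end

/-! ### The automaton of a profile -/

namespace Profile

variable {α : Type*} {P : Profile α} {L : TimedLanguage α} {K : ℕ}

theorem constant_le (h : P.C K) : P.constant ≤ K := iInf₂_le K h

theorem C_of_constant_eq (h : P.constant = K) : P.C K := by
  have himage : P.constant = sInf ((fun k : ℕ => (k : ℕ∞)) '' {k | P.C k}) := sInf_image.symm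
  have hne : {k | P.C k}.Nonempty := by
    refine Set.nonempty_iff_ne_empty.2 fun hempty => ?_
    rw [himage, hempty, Set.image_empty, sInf_empty] at h
    exact ENat.top_ne_natCast K h
  obtain ⟨k, hk, hkK⟩ := csInf_mem (hne.image fun k : ℕ => (k : ℕ∞))
  obtain rfl : k = K := Nat.cast_injective (R := ℕ∞) (hkK.trans (himage.symm.trans h))
  exact hk

theorem R_eq_regionIndex_div_two (P : Profile α) (w : HIWord α) :
    P.R w.1 = (regionIndex (P.R w.1) : ℝ≥0) / 2 := by
  obtain ⟨m, hm⟩ := P.isReset.exists_natCast_div_two w.2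
  rw [hm, regionIndex_natCast_div_two]

theorem regionIndex_R_add (P : Profile α) (w : HIWord α) (n : ℕ) :
    regionIndex (P.R w.1 + (n : ℝ≥0) / 2) = regionIndex (P.R w.1) + n := by
  rw [P.R_eq_regionIndex_div_two w, ← add_div, ← Nat.cast_add, regionIndex_natCast_div_two,
    regionIndex_natCast_div_two]

theorem regionIndex_R_normalFormHI (hP : P.Monotonic) (w : TimedWord α) :
    regionIndex (P.R (normalFormHI P.R w).1) = regionIndex (P.R w) :=
  (regionEquiv_iff_regionIndex.1 (hP.2 w)).symm

theorem min_regionIndex_R_eq (hP : P.Monotonic) (hK : P.constant = K) {v w : HIWord α}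
    (h : P.equiv v w) :
    min (regionIndex (P.R v.1)) (2 * K + 1) = min (regionIndex (P.R w.1)) (2 * K + 1) := by
  rw [← regionEquivUpTo_natCast_iff, ← hK]
  exact (hP.1 v w h).1

theorem equiv_snoc_of_regionEquivUpTo (hP : P.Monotonic) (hK : P.constant = K) {v w : HIWord α}
    (h : P.equiv v w) {m n : ℕ}
    (hregion : RegionEquivUpTo K (P.R v.1 + (m : ℝ≥0) / 2) (P.R w.1 + (n : ℝ≥0) / 2)) (a : α) :
    P.equiv (v.snoc m a) (w.snoc n a) := by
  by_cases hlt : (K : ℝ≥0) < P.R v.1 + (m : ℝ≥0) / 2 ∧ (K : ℝ≥0) < P.R w.1 + (n : ℝ≥0) / 2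
  · have hC := C_of_constant_eq hK
    exact P.equiv.trans' (P.equiv.trans' (hC v a m hlt.1) ((hP.1 v w h).2 _ a))
      (P.equiv.symm' (hC w a n hlt.2))
  · obtain rfl : m = n := by
      have hR := min_regionIndex_R_eq hP hK h
      rw [regionEquivUpTo_natCast_iff] at hregion
      simp only [natCast_lt_iff_regionIndex, regionIndex_R_add] at hlt hregion
      omega
    exact (hP.1 v w h).2 m a

open Classical in
/-- The machine whose states are the classes of a profile. From the class of `u`, a letter read in
the region of index `i` leads to the class of `u (n/2 · a)`, where `n` is chosen such that
`R u + n/2` lies in that region; the clock is reset if `R` vanishes there. Along runs the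
subtraction truncates only if `R u > K`, where `C K` makes all delays equivalent. -/
noncomputable def machine (P : Profile α) (L : TimedLanguage α) (K : ℕ) :
    RegionMachine α (Quotient P.equiv) where
  step c a i :=
    let v := c.out.snoc (min i (2 * K + 1) - regionIndex (P.R c.out.1)) a
    (⟦v⟧, decide (P.R v.1 = 0))
  final := {c | c.out.1 ∈ L}

theorem machine_isBounded : (P.machine L K).IsBounded K := fun c a i => by
  simp only [machine, min_assoc, min_self]

theorem R_eq_zero_iff_of_equiv_normalFormHI (hP : P.Monotonic) (hK : P.constant = K)
    {v : HIWord α} {w : TimedWord α} (h : P.equiv v (normalFormHI P.R w)) :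
    P.R v.1 = 0 ↔ P.R w = 0 := by
  have hmin := min_regionIndex_R_eq hP hK h
  rw [regionIndex_R_normalFormHI hP] at hmin
  rw [← regionIndex_eq_zero_iff, ← regionIndex_eq_zero_iff (x := P.R w)]
  omega

theorem run_machine (hP : P.Monotonic) (hK : P.constant = K) (w : TimedWord α) :
    (P.machine L K).run (⟦normalFormHI P.R []⟧, 0) w = (⟦normalFormHI P.R w⟧, P.R w) := by
  induction w using List.reverseRecOn with
  | nil => rw [P.isReset.1]; rfl
  | append_singleton w z ih =>
    obtain ⟨t, a⟩ := z
    rw [RegionMachine.run_snoc, ih]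
    set c : Quotient P.equiv := ⟦normalFormHI P.R w⟧
    have hout : P.equiv c.out (normalFormHI P.R w) := Quotient.mk_out _
    have hequiv : P.equiv
        (c.out.snoc (min (regionIndex (P.R w + t)) (2 * K + 1) - regionIndex (P.R c.out.1)) a)
        (normalFormHI P.R (w ++ [(t, a)])) := by
      rw [normalFormHI_snoc]
      refine equiv_snoc_of_regionEquivUpTo hP hK hout ?_ a
      have hmin := min_regionIndex_R_eq hP hK hout
      have hle := regionIndex_mono (le_self_add : P.R w ≤ P.R w + t)
      rw [regionEquivUpTo_natCast_iff, regionIndex_R_add, regionIndex_R_add]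
      rw [regionIndex_R_normalFormHI hP] at hmin ⊢
      omega
    have hzero := R_eq_zero_iff_of_equiv_normalFormHI hP hK hequiv
    refine Prod.ext (Quotient.sound hequiv) ?_
    simp only [RegionMachine.move, machine, decide_eq_true_eq, hzero]
    split_ifs with h
    · exact h.symm
    · exact ((P.isReset.2 w t a).resolve_left h).symm

theorem language_machine (hP : P.Monotonic) (hK : P.constant = K) (hL : P.Preserves L) :
    (P.machine L K).language (⟦normalFormHI P.R []⟧, 0) = L := by
  ext w
  change ((P.machine L K).run _ w).1.out.1 ∈ L ↔ w ∈ L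
  rw [run_machine hP hK, hL.2 w]
  exact hL.1 _ _ (Quotient.mk_out (normalFormHI P.R w))

theorem minConstant_le_constant (hP : P.Monotonic) (hL : P.Preserves L)
    [Finite (Quotient P.equiv)] (hfin : (letters L).Finite) :
    (minConstant L : ℕ∞) ≤ P.constant := by
  induction hK : P.constant with
  | top => exact le_top
  | coe K =>
    rw [← language_machine hP hK hL] at hfin
    obtain ⟨A, hA, hle, hlang⟩ := machine_isBounded.exists_automaton hfin
    rw [language_machine hP hK hL] at hlang
    exact_mod_cast (Nat.sInf_le ⟨A, hA, rfl, hlang⟩ : minConstant L ≤ A.maxConst).trans hle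

end Profile

/-! ### Index and constant of the syntactic profile -/

namespace RegionMachine

variable {α S : Type*} {M : RegionMachine α S} {K : ℕ}

theorem IsBounded.language_move_eq_of_lt (hM : M.IsBounded K) {c : S × ℝ≥0} {t t' : ℝ≥0}
    (h : (K : ℝ≥0) < c.2 + t) (h' : (K : ℝ≥0) < c.2 + t') (a : α) :
    M.language (M.move c (t, a)) = M.language (M.move c (t', a)) := by
  simp only [move, hM.step_congr (Or.inr ⟨K, rfl, h, h'⟩) c.1 a]
  split_ifs
  · rfl
  · exact hM.language_eq_of_lt _ h h'

theorem IsBounded.language_min_div_two (hM : M.IsBounded K) (s : S) (n : ℕ) :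
    M.language (s, ((min n (2 * K + 1) : ℕ) : ℝ≥0) / 2) = M.language (s, (n : ℝ≥0) / 2) := by
  rcases le_or_gt n (2 * K + 1) with h | h
  · rw [min_eq_left h]
  · rw [min_eq_right h.le]
    exact hM.language_eq_of_lt s (natCast_lt_natCast_div_two_iff.2 (by omega))
      (natCast_lt_natCast_div_two_iff.2 (by omega))

end RegionMachine

namespace OneTA.Deterministic

variable {α : Type*} {A : OneTA α}

theorem syntacticReset_le_clock (hA : A.Deterministic) (w : TimedWord α) :
    syntacticReset A.language w ≤ (A.regionMachine.run (some A.init, 0) w).2 := by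
  induction w using List.reverseRecOn with
  | nil => exact (syntacticReset_nil _).le
  | append_singleton w z ih =>
    obtain ⟨t, a⟩ := z
    rw [syntacticReset_snoc, hA.residual_language, RegionMachine.run_snoc]
    split_ifs with hrec
    · exact zero_le
    · simp only [RegionMachine.move] at hrec ⊢
      split_ifs at hrec ⊢
      · exact absurd (hA.isRecognizable_language_zero _) hrec
      · gcongr

theorem isRecognizable_residual_snoc_of_lt (hA : A.Deterministic) {w : TimedWord α} {t : ℝ≥0}
    (h : (A.maxConst : ℝ≥0) < syntacticReset A.language w + t) (a : α) :
    IsRecognizable (residual (w ++ [(t, a)]) A.language) := by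
  have hclock := h.trans_le (add_le_add_left (hA.syntacticReset_le_clock w) t)
  rw [hA.residual_language, RegionMachine.run_snoc, RegionMachine.move]
  split_ifs
  · exact hA.isRecognizable_language_zero _
  · exact hA.isRecognizable_language_of_lt _ hclock

theorem syntacticReset_le_maxConst (hA : A.Deterministic) (w : TimedWord α) :
    syntacticReset A.language w ≤ A.maxConst := by
  rcases List.eq_nil_or_concat' w with rfl | ⟨w, ⟨t, a⟩, rfl⟩
  · exact (syntacticReset_nil _).trans_le zero_le
  · rw [syntacticReset_snoc]
    split_ifs with hrec
    · exact zero_le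
    · exact not_lt.1 fun h => hrec (hA.isRecognizable_residual_snoc_of_lt h a)

theorem syntacticProfile_C_maxConst (hA : A.Deterministic) :
    (syntacticProfile A.language).C A.maxConst := by
  intro w a n h
  have h' : (A.maxConst : ℝ≥0) <
      syntacticReset A.language w.1 + ((2 * A.maxConst + 1 : ℕ) : ℝ≥0) / 2 :=
    (natCast_lt_natCast_div_two_iff.2 (Nat.lt_succ_self _)).trans_le le_add_self
  have hle := hA.syntacticReset_le_clock w.1
  refine ⟨?_, ?_⟩
  · exact (syntacticReset_eq_zero (hA.isRecognizable_residual_snoc_of_lt h a)).trans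
      (syntacticReset_eq_zero (hA.isRecognizable_residual_snoc_of_lt h' a)).symm
  · simp only [HIWord.snoc, hA.residual_language, RegionMachine.run_snoc]
    exact A.regionMachine_isBounded.language_move_eq_of_lt (h.trans_le (add_le_add_left hle _))
      (h'.trans_le (add_le_add_left hle _)) a

theorem finite_range_syntacticReset (hA : A.Deterministic) :
    (Set.range fun w : HIWord α => syntacticReset A.language w.1).Finite := by
  refine ((Set.finite_Iic (2 * A.maxConst)).image fun m : ℕ => (m : ℝ≥0) / 2).subset ?_
  rintro _ ⟨w, rfl⟩
  obtain ⟨m, hm⟩ := (syntacticReset_isResetFunction A.language).exists_natCast_div_two w.2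
  have hle := hA.syntacticReset_le_maxConst w.1
  rw [hm, ← not_lt, natCast_lt_natCast_div_two_iff, not_lt] at hle
  exact ⟨m, hle, hm.symm⟩

theorem finite_range_residual (hA : A.Deterministic) :
    (Set.range fun w : HIWord α => residual w.1 A.language).Finite := by
  have := A.finite_state
  refine (((Set.finite_univ (α := Option A.State)).prod
    (Set.finite_Iic (2 * A.maxConst + 1))).image fun i =>
      A.regionMachine.language (i.1, (i.2 : ℝ≥0) / 2)).subset ?_
  rintro _ ⟨w, rfl⟩
  obtain ⟨n, hn⟩ :=
    (A.regionMachine.isResetFunction_clock (some A.init)).exists_natCast_div_two w.2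
  refine ⟨((A.regionMachine.run (some A.init, 0) w.1).1, min n (2 * A.maxConst + 1)),
    ⟨Set.mem_univ _, Set.mem_Iic.2 (min_le_right _ _)⟩, ?_⟩
  dsimp only
  rw [A.regionMachine_isBounded.language_min_div_two, ← hn, hA.residual_language]

theorem finite_quotient_syntacticProfile (hA : A.Deterministic) :
    Finite (Quotient (syntacticProfile A.language).equiv) := by
  set f : HIWord α → ℝ≥0 × TimedLanguage α :=
    fun w => (syntacticReset A.language w.1, residual w.1 A.language)
  have hker : (syntacticProfile A.language).equiv = Setoid.ker f :=
    Setoid.ext fun v w => (Prod.ext_iff (x := f v) (y := f w)).symm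
  have hfin : (Set.range f).Finite :=
    (hA.finite_range_syntacticReset.prod hA.finite_range_residual).subset <|
      Set.range_subset_iff.2 fun w => ⟨⟨w, rfl⟩, ⟨w, rfl⟩⟩
  have := hfin.to_subtype
  rw [hker]
  exact Finite.of_equiv _ (Setoid.quotientKerEquivRange f).symm

end OneTA.Deterministic

theorem IsRecognizable.syntacticProfile_finiteIndex {α : Type*} {L : TimedLanguage α}
    (hL : IsRecognizable L) : (syntacticProfile L).FiniteIndex := by
  obtain ⟨A, hA, rfl⟩ := hL
  exact ⟨hA.finite_quotient_syntacticProfile,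
    (Profile.constant_le hA.syntacticProfile_C_maxConst).trans_lt (ENat.natCast_lt_top _)⟩

theorem IsRecognizable.syntacticProfile_constant_le {α : Type*} {L : TimedLanguage α}
    (hL : IsRecognizable L) : (syntacticProfile L).constant ≤ minConstant L := by
  obtain ⟨B, hB, hBL⟩ := hL
  obtain ⟨A, hA, hmax, rfl⟩ :
      ∃ A : OneTA α, A.Deterministic ∧ A.maxConst = minConstant L ∧ A.language = L :=
    Nat.sInf_mem (s := {K | ∃ A : OneTA α, A.Deterministic ∧ A.maxConst = K ∧ A.language = L})
      ⟨_, B, hB, rfl, hBL⟩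
  rw [← hmax]
  exact Profile.constant_le hA.syntacticProfile_C_maxConst

end OneClock

theorem mainTheorem4_general {α : Type*} (L : OneClock.TimedLanguage α)
    (hL : OneClock.IsRecognizable L) :
    (OneClock.syntacticProfile L).Preserves L ∧
      (OneClock.syntacticProfile L).Monotonic ∧
      (OneClock.syntacticProfile L).FiniteIndex ∧
      (OneClock.syntacticProfile L).constant = (OneClock.minConstant L : ℕ∞) := by
  have hpreserves := OneClock.syntacticProfile_preserves hL
  have hmonotonic := OneClock.syntacticProfile_monotonic hL
  have hindex := hL.syntacticProfile_finiteIndex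
  have := hindex.1
  exact ⟨hpreserves, hmonotonic, hindex, hL.syntacticProfile_constant_le.antisymm
    (OneClock.Profile.minConstant_le_constant hmonotonic hpreserves hL.finite_letters)⟩

theorem mainTheorem4 {α : Type*} [Finite α] (L : OneClock.TimedLanguage α)
    (hL : OneClock.IsRecognizable L) :
    (OneClock.syntacticProfile L).Preserves L ∧
      (OneClock.syntacticProfile L).Monotonic ∧
      (OneClock.syntacticProfile L).FiniteIndex ∧
      (OneClock.syntacticProfile L).constant = (OneClock.minConstant L : ℕ∞) :=
  mainTheorem4_general L hL
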